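/- Decentralized list scheduling (DLS) of unit independent tasks. There are $m\ge 2$ identical processors; processor $i$ owns a queue containing $w_i(t)$ unit tasks at time $t=0,1,2,\dots$. The initial values $w_i=w_i(0)$ are arbitrary, and $W=\sum_i w_i$. During each time slot, every processor $i$ with $w_i(t)\ge 1$ executes one of its tasks. Every processor $j$ with $w_j(t)=0$ sends a steal request to a processor chosen uniformly at random among the $m-1$ others, independently of everything else. A request to a queue with at most one task fails. If a queue with $w_i(t)\ge 2$ tasks receives one or more requests, exactly one of them, chosen uniformly at random, is served, and the others fail: if $j$ is the served thief, then $w_i(t+1)=\lceil (w_i(t)-1)/2\rceil$ and $w_j(t+1)=\lfloor (w_i(t)-1)/2\rfloor$. An active processor which receives no request has $w_i(t+1)=w_i(t)-1$, and a thief that is not served keeps an empty queue. The makespan $C_{\max}$ is the first time at which all queues are empty. Put $$\Phi_0=\sum_{i=1}^m\Bigl(w_i-\frac Wm\Bigr)^2,\qquad \lambda=\frac{1}{1-\log_2(1+\frac1e)} .$$ **Theorem.** For every $m\ge2$ and every initial repartition of the tasks: (i) if $\Phi_0>0$, then $$\mathbb E[C_{\max}]\le \frac Wm+\lambda\Bigl(\log_2\Phi_0+\frac1{\ln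 2}\Bigr)+1;$$ (ii) for every $\varepsilon>0$, if $\Phi_0\ge 1$ or $\varepsilon\le\Phi_0$, then $$\mathbb P\Bigl[C_{\max}\ge \frac Wm+\lambda\Bigl(\log_2\Phi_0+\log_2\frac1\varepsilon\Bigr)+1\Bigr]\le\varepsilon;$$ (iii) in particular, if $W\ge1$, then $$\mathbb E[C_{\max}]\le \frac Wm+2\lambda\Bigl(\log_2 W+\frac1{2\ln 2}\Bigr)+1,\qquad\text{where } 2\lambda<3.65 .$$ These bounds are optimal up to a constant factor of the logarithmic term. Indeed, for every $k\ge1$, if $m=2^k$ and $W=2^{k+1}$ tasks are initially all in one queue, then almost surely, and hence also in expectation, $C_{\max}\ge \frac Wm+\log_2W-1$. Consequently, for real constants $c$ and $C$: * if $\mathbb E[C_{\max}]\le \frac Wm+c\log_2\Phi_0+C$ for all $m\ge2$ and all initial repartitions with $\Phi_0>0$, then $c\ge\frac12$; * if, for some $\varepsilon\in(0,1)$, $\mathbb P[C_{\max}\ge \frac Wm+c\log_2\Phi_0+C]\le\varepsilon$ for all $m\ge2$ and all initial repartitions with $\Phi_0\ge1$, then $c\ge\frac12$; * if $\mathbb E[C_{\max}]\le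 \frac Wm+c\log_2W+C$ for all $m\ge2$ and all initial repartitions with $W\ge1$, then $c\ge1$. -/

import Mathlib

open MeasureTheory ProbabilityTheory
open scoped ENNReal

namespace DLS

/-- A configuration of the queues: `w i` is the number of unit tasks in the queue of processor `i`
(the task being executed included). -/
abbrev Config (m : ℕ) : Type := Fin m → ℕ

/-- The total number of tasks in the system. -/
def totalWork {m : ℕ} (w : Config m) : ℕ := ∑ i, w i

/-- The potential `∑ i, (w i - W / m) ^ 2`, where `W` is the total number of tasks. -/
noncomputable def potential {m : ℕ} (w : Config m) : ℝ :=
  ∑ i, ((w i : ℝ) - (totalWork w : ℝ) / (m : ℝ)) ^ 2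

/-- The idle processors whose steal request is sent to processor `k`,
when `target i` is the processor that `i` would steal from. -/
def requesters {m : ℕ} (w : Config m) (target : Fin m → Fin m) (k : Fin m) : Finset (Fin m) :=
  {i | w i = 0 ∧ target i = k}

/-- The configuration after one time slot, given the targets of the steal requests and, for every
processor `k` that receives requests, the one requester `winner k` that is served.

* A processor `i` with an empty queue sends a request to `target i`. If that queue has more than one
  task and `i` is the served requester, then `i` receives half (rounded down) of the tasks which
  remain there once the task being executed has been removed. Otherwise the request fails.
* A processor `i` with a nonempty queue executes one task. If it has more than one task and receives
  a request, then it also gives away half (rounded down) of its `w i - 1` remaining tasks. -/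
def next {m : ℕ} (w : Config m) (target winner : Fin m → Fin m) : Config m := fun i =>
  if w i = 0 then
    if 2 ≤ w (target i) ∧ winner (target i) = i then (w (target i) - 1) / 2 else 0
  else
    if 2 ≤ w i ∧ (requesters w target i).Nonempty then (w i - 1) - (w i - 1) / 2 else w i - 1

/-- Every processor draws independently and uniformly a processor other than itself
(only the draws of idle processors are used). -/
noncomputable def targetLaw {m : ℕ} (hm : 2 ≤ m) : PMF (Fin m → Fin m) :=
  PMF.uniformOfFinset (Fintype.piFinset fun i : Fin m => Finset.univ.erase i) <| by
    have : Nontrivial (Fin m) := Fin.nontrivial_iff_two_le.mpr hm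
    refine Fintype.piFinset_nonempty.mpr fun i => ?_
    obtain ⟨j, hj⟩ := exists_ne i
    exact ⟨j, Finset.mem_erase.mpr ⟨hj, Finset.mem_univ j⟩⟩

/-- Independently for every processor `k`, the served requester is uniform among the requesters
of `k` (the value is irrelevant, and set to `k`, when there are none). -/
noncomputable def winnerLaw {m : ℕ} (w : Config m) (target : Fin m → Fin m) :
    PMF (Fin m → Fin m) :=
  PMF.uniformOfFinset
    (Fintype.piFinset fun k : Fin m =>
      if (requesters w target k).Nonempty then requesters w target k else {k}) <| by
    refine Fintype.piFinset_nonempty.mpr fun k => ?_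
    split_ifs with h
    · exact h
    · exact Finset.singleton_nonempty k

/-- The law of the configuration at time `t + 1`, given the configuration `w` at time `t`. -/
noncomputable def stepLaw {m : ℕ} (hm : 2 ≤ m) (w : Config m) : PMF (Config m) :=
  (targetLaw hm).bind fun target => (winnerLaw w target).map (next w target)

/-- The transition kernel at time `t`: the next configuration is drawn from `stepLaw`, applied to
the current configuration. -/
noncomputable def stepKernel {m : ℕ} (hm : 2 ≤ m) (t : ℕ) :
    Kernel ((s : Finset.Iic t) → (fun _ : ℕ => Config m) s) (Config m) :=
  Kernel.ofFunOfCountable fun past =>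
    (stepLaw hm (past ⟨t, Finset.mem_Iic.mpr le_rfl⟩)).toMeasure

instance {m : ℕ} (hm : 2 ≤ m) (t : ℕ) : IsMarkovKernel (stepKernel hm t) :=
  ⟨fun past => by
    change IsProbabilityMeasure
      (stepLaw hm (past ⟨t, Finset.mem_Iic.mpr le_rfl⟩)).toMeasure
    infer_instance⟩

/-- The law of the whole execution `w(0), w(1), w(2), …` of decentralized list scheduling
on `m` processors, started from the configuration `w₀`. -/
noncomputable def executionLaw {m : ℕ} (hm : 2 ≤ m) (w₀ : Config m) : Measure (ℕ → Config m) :=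
  Kernel.trajMeasure (X := fun _ => Config m) (Measure.dirac w₀) (stepKernel hm)

/-- The makespan `C_max`: the first time at which all queues are empty (`⊤` if there is none). -/
noncomputable def makespan {m : ℕ} (w : ℕ → Config m) : ℕ∞ :=
  ⨅ (t : ℕ) (_ : ∀ i, w t i = 0), (t : ℕ∞)

/-- The expectation of the makespan, possibly infinite. -/
noncomputable def expectedMakespan {m : ℕ} (hm : 2 ≤ m) (w₀ : Config m) : ℝ≥0∞ :=
  ∫⁻ w, (makespan w : ℝ≥0∞) ∂(executionLaw hm w₀)

/-- The probability that the makespan is at least `x`. -/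
noncomputable def tailMakespan {m : ℕ} (hm : 2 ≤ m) (w₀ : Config m) (x : ℝ) : ℝ≥0∞ :=
  executionLaw hm w₀ {w | ENNReal.ofReal x ≤ (makespan w : ℝ≥0∞)}

/-- The constant `1 / (1 - log₂ (1 + 1 / e))`. -/
noncomputable def lam : ℝ := 1 / (1 - Real.logb 2 (1 + 1 / Real.exp 1))

end DLS

/-! Upper bounds. Let `ρ` be the fraction of idle processors at some time. In the next slot `W/m`
falls by exactly `1 - ρ` (`totalWork_next_div`), and the expected potential is multiplied by at most
`2 ^ (-ρ/λ)` (`stepExpect_potential_le`). The part `ρ` of the slot that is lost for work is thus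
paid for by the potential, at the price of `λ` slots per halving.

The decay holds because an active queue receives a request with probability `p = 1 -
((m-2)/(m-1))^r`, where `r = ρ m`, and a served request halves the sum of squares of the two queues
up to a parity term. Idleness compensates for the parity terms (`mean_potential_le`), leaving the
factor `1 - p/2`, at most `(1 + e^(-ρ))/2 ≤ ((1 + e⁻¹)/2)^ρ = 2 ^ (-ρ/λ)`.

Both bounds follow by induction on time, conditioning on the first slot. For the tail, being alive
`x` slots after `W/m` has probability at most `Φ₀ 2 ^ (-x/λ)` (`aliveProb_le`). For the mean, the
concave `log₂ Φ` is replaced by the affine majorants `log₂ y + Φ/(y ln 2)`, through which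
expectations pass exactly (`sum_aliveProb_le`). The induction bottoms out at balanced
configurations: there no steal succeeds, the evolution is deterministic, and outside them `Φ ≥ 2`.

Lower bound. A queue at most halves in one slot (`half_le_next`), so `2 ^ n` tasks in one queue
force a makespan of at least `n + 1`, whatever the draws. -/

namespace DLS

/-! ### Expectations along the execution -/

/-- The expectation of `f` after one time slot started from `w`. -/
noncomputable def stepExpect {m : ℕ} (hm : 2 ≤ m) (f : Config m → ℝ≥0∞) (w : Config m) : ℝ≥0∞ :=
  ∑' w', stepLaw hm w w' * f w'

lemma lintegral_stepKernel {m : ℕ} (hm : 2 ≤ m) (t : ℕ)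
    (past : (s : Finset.Iic t) → (fun _ : ℕ => Config m) s) (f : Config m → ℝ≥0∞) :
    ∫⁻ w, f w ∂(stepKernel hm t past) =
      stepExpect hm f (past ⟨t, Finset.mem_Iic.mpr le_rfl⟩) := by
  change ∫⁻ w, f w ∂((stepLaw hm (past ⟨t, Finset.mem_Iic.mpr le_rfl⟩)).toMeasure) = _
  rw [lintegral_countable']
  simp only [PMF.toMeasure_apply_singleton _ _ (measurableSet_singleton _), mul_comm, stepExpect]

instance {m : ℕ} (hm : 2 ≤ m) (w₀ : Config m) : IsProbabilityMeasure (executionLaw hm w₀) := by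
  unfold executionLaw; infer_instance

lemma lintegral_executionLaw_zero {m : ℕ} (hm : 2 ≤ m) (w₀ : Config m) (f : Config m → ℝ≥0∞) :
    ∫⁻ w, f (w 0) ∂(executionLaw hm w₀) = f w₀ := by
  have h : (executionLaw hm w₀).map (Preorder.frestrictLe (π := fun _ : ℕ => Config m) 0) =
      Measure.dirac ((MeasurableEquiv.piUnique
        (fun i : Finset.Iic 0 => (fun _ : ℕ => Config m) i)).symm w₀) := by
    rw [executionLaw, Kernel.trajMeasure, Measure.map_comp _ _ (by fun_prop),
      Kernel.traj_map_frestrictLe, Kernel.partialTraj_self, Measure.id_comp,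
      Measure.map_dirac' (by fun_prop)]
  have h2 : ∫⁻ w, f (w 0) ∂(executionLaw hm w₀) =
      ∫⁻ x, f (x ⟨0, Finset.mem_Iic.mpr le_rfl⟩) ∂((executionLaw hm w₀).map
        (Preorder.frestrictLe (π := fun _ : ℕ => Config m) 0)) := by
    rw [lintegral_map (measurable_of_countable _) (by fun_prop)]
    rfl
  rw [h2, h, lintegral_dirac' _ (measurable_of_countable _)]
  rfl

/-- The joint law of the past up to `t` and of the next configuration is the composition product
with `stepKernel`, so the last coordinate can be integrated first. -/
lemma lintegral_executionLaw_succ {m : ℕ} (hm : 2 ≤ m) (w₀ : Config m) (t : ℕ)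
    (f : Config m → ℝ≥0∞) :
    ∫⁻ w, f (w (t + 1)) ∂(executionLaw hm w₀) =
      ∫⁻ w, stepExpect hm f (w t) ∂(executionLaw hm w₀) := by
  have h := Kernel.map_frestrictLe_trajMeasure_compProd_eq_map_trajMeasure
    (X := fun _ => Config m) (κ := stepKernel hm) (μ₀ := Measure.dirac w₀) (a := t)
  have hf : Measurable f := measurable_of_countable f
  have h1 := congrArg (fun μ => ∫⁻ x, f x.2 ∂μ) h
  rw [lintegral_map (by fun_prop) (by fun_prop), Measure.lintegral_compProd (by fun_prop),
    lintegral_map (measurable_of_countable _) (by fun_prop)] at h1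
  simp only [lintegral_stepKernel] at h1
  exact h1.symm

/-- The law of the configuration at time `t` is obtained by iterating `stepExpect`. -/
lemma lintegral_executionLaw {m : ℕ} (hm : 2 ≤ m) (w₀ : Config m) (t : ℕ)
    (f : Config m → ℝ≥0∞) :
    ∫⁻ w, f (w t) ∂(executionLaw hm w₀) = (stepExpect hm)^[t] f w₀ := by
  induction t generalizing f with
  | zero => exact lintegral_executionLaw_zero hm w₀ f
  | succ t ih => rw [lintegral_executionLaw_succ, ih, Function.iterate_succ_apply]

/-! ### Survival probabilities and the makespan -/

/-- The probability that some queue is nonempty at time `t`. -/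
noncomputable def aliveProb {m : ℕ} (hm : 2 ≤ m) (t : ℕ) : Config m → ℝ≥0∞ :=
  (stepExpect hm)^[t] (fun w => if w = 0 then 0 else 1)

lemma aliveProb_zero {m : ℕ} (hm : 2 ≤ m) (w : Config m) :
    aliveProb hm 0 w = if w = 0 then 0 else 1 := rfl

lemma aliveProb_succ {m : ℕ} (hm : 2 ≤ m) (t : ℕ) (w : Config m) :
    aliveProb hm (t + 1) w = stepExpect hm (aliveProb hm t) w := by
  simp only [aliveProb, Function.iterate_succ_apply']

lemma executionLaw_ne_zero {m : ℕ} (hm : 2 ≤ m) (w₀ : Config m) (t : ℕ) :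
    executionLaw hm w₀ {w | w t ≠ 0} = aliveProb hm t w₀ := by
  rw [aliveProb, ← lintegral_executionLaw, ← lintegral_indicator_one]
  · congr 1 with w
    by_cases h : w t = 0 <;> simp [Set.indicator, h]
  · exact (measurableSet_singleton (0 : Config m)).compl.preimage (measurable_pi_apply t)

lemma aliveProb_le_one {m : ℕ} (hm : 2 ≤ m) (t : ℕ) (w : Config m) : aliveProb hm t w ≤ 1 := by
  rw [← executionLaw_ne_zero]; exact prob_le_one

lemma le_makespan_iff {m : ℕ} (w : ℕ → Config m) (n : ℕ) :
    (n : ℕ∞) ≤ makespan w ↔ ∀ t < n, w t ≠ 0 := by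
  simp only [makespan, le_iInf_iff, Nat.cast_le, ne_eq, funext_iff, Pi.zero_apply]
  exact ⟨fun h t ht h0 => absurd (h t h0) (by omega), fun h t h0 => by
    by_contra hlt; exact h t (by omega) h0⟩

lemma makespan_le_tsum {m : ℕ} (w : ℕ → Config m) :
    (makespan w : ℝ≥0∞) ≤ ∑' t, if w t = 0 then 0 else 1 := by
  have key : ∀ n : ℕ, (n : ℕ∞) ≤ makespan w →
      (n : ℝ≥0∞) ≤ ∑' t, if w t = 0 then (0 : ℝ≥0∞) else 1 := fun n hn => by
    refine le_trans (le_of_eq ?_) (ENNReal.sum_le_tsum (Finset.range n))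
    rw [le_makespan_iff] at hn
    rw [Finset.sum_congr rfl (g := fun _ => (1 : ℝ≥0∞))
      fun t ht => if_neg (hn t (Finset.mem_range.mp ht))]
    simp
  cases h : makespan w with
  | top =>
    refine le_of_le_of_eq le_top (Eq.symm ?_)
    refine ENNReal.eq_top_of_forall_nnreal_le fun r => ?_
    obtain ⟨n, hn⟩ := exists_nat_ge r
    exact le_trans (by exact_mod_cast hn) (key n (by simp [h]))
  | coe n => simpa using key n (by simp [h])

lemma expectedMakespan_le_tsum {m : ℕ} (hm : 2 ≤ m) (w₀ : Config m) :
    expectedMakespan hm w₀ ≤ ∑' t, aliveProb hm t w₀ := by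
  refine (lintegral_mono makespan_le_tsum).trans (le_of_eq ?_)
  rw [lintegral_tsum]
  · exact tsum_congr fun t => lintegral_executionLaw hm w₀ t (fun v => if v = 0 then 0 else 1)
  · exact fun t => ((measurable_of_countable
      (fun v : Config m => if v = 0 then (0 : ℝ≥0∞) else 1)).comp
        (measurable_pi_apply t)).aemeasurable

lemma tailMakespan_le {m : ℕ} (hm : 2 ≤ m) (w₀ : Config m) (x : ℝ) (t : ℕ) (h : (t : ℝ) < x) :
    tailMakespan hm w₀ x ≤ aliveProb hm t w₀ := by
  rw [← executionLaw_ne_zero]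
  refine measure_mono fun w hw => ?_
  have h1 : ((t : ℕ∞) : ℝ≥0∞) < (makespan w : ℝ≥0∞) := by
    refine lt_of_lt_of_le ?_ hw
    rw [ENat.toENNReal_coe, ← ENNReal.ofReal_natCast]
    exact (ENNReal.ofReal_lt_ofReal_iff (lt_of_le_of_lt t.cast_nonneg h)).mpr h
  rw [ENat.toENNReal_lt] at h1
  have h2 : ((t + 1 : ℕ) : ℕ∞) ≤ makespan w := by
    push_cast
    exact Order.add_one_le_of_lt h1
  exact (le_makespan_iff w (t + 1)).mp h2 t (by omega)

/-! ### Averaging over the random choices of one slot -/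

lemma stepExpect_eq {m : ℕ} (hm : 2 ≤ m) (f : Config m → ℝ≥0∞) (w : Config m) :
    stepExpect hm f w =
      ∑' T, targetLaw hm T * ∑' V, winnerLaw w T V * f (next w T V) := by
  simp only [stepExpect, stepLaw, PMF.bind_apply, ← ENNReal.tsum_mul_right]
  rw [ENNReal.tsum_comm]
  refine tsum_congr fun T => ?_
  simp only [mul_assoc, ENNReal.tsum_mul_left]
  congr 1
  simp only [PMF.map_apply, ← ENNReal.tsum_mul_right]
  rw [ENNReal.tsum_comm]
  refine tsum_congr fun V => ?_
  rw [tsum_eq_single (next w T V)]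
  · simp
  · intro b hb; simp [hb]

/-- The served requester of every queue that receives requests is one of its requesters. -/
def IsValidWinner {m : ℕ} (w : Config m) (T V : Fin m → Fin m) : Prop :=
  ∀ k, (requesters w T k).Nonempty → V k ∈ requesters w T k

/-- The set of possible targets of the steal requests. -/
def targets (m : ℕ) : Finset (Fin m → Fin m) :=
  Fintype.piFinset fun i : Fin m => Finset.univ.erase i

lemma card_targets (m : ℕ) : (targets m).card = (m - 1) ^ m := by
  simp [targets, Fintype.card_piFinset]

lemma targetLaw_of_mem {m : ℕ} (hm : 2 ≤ m) {T : Fin m → Fin m} (hT : T ∈ targets m) :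
    targetLaw hm T = (((m - 1) ^ m : ℕ) : ℝ≥0∞)⁻¹ := by
  rw [← card_targets]
  exact PMF.uniformOfFinset_apply_of_mem _ hT

lemma targetLaw_of_notMem {m : ℕ} (hm : 2 ≤ m) {T : Fin m → Fin m} (hT : T ∉ targets m) :
    targetLaw hm T = 0 :=
  PMF.uniformOfFinset_apply_of_notMem _ hT

lemma exists_isValidWinner {m : ℕ} (w : Config m) (T : Fin m → Fin m) :
    ∃ V, IsValidWinner w T V := by
  classical
  exact ⟨fun k => if h : (requesters w T k).Nonempty then h.choose else k,
    fun k h => by simpa only [dif_pos h] using h.choose_spec⟩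

lemma winnerLaw_eq_zero {m : ℕ} (w : Config m) (T V : Fin m → Fin m)
    (h : ¬ IsValidWinner w T V) : winnerLaw w T V = 0 := by
  rw [winnerLaw, PMF.uniformOfFinset_apply_of_notMem]
  intro hV
  refine h fun k hk => ?_
  have := Fintype.mem_piFinset.mp hV k
  rwa [if_pos hk] at this

/-- The bound `G` sees only the targets: work and potential are symmetric in the processors, so the
identity of the served thief does not affect them. -/
lemma stepExpect_le {m : ℕ} (hm : 2 ≤ m) (f : Config m → ℝ≥0∞) (w : Config m)
    (G : (Fin m → Fin m) → ℝ≥0∞)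
    (h : ∀ T ∈ targets m, ∀ V, IsValidWinner w T V → f (next w T V) ≤ G T) :
    stepExpect hm f w ≤ ∑ T ∈ targets m, (((m - 1) ^ m : ℕ) : ℝ≥0∞)⁻¹ * G T := by
  rw [stepExpect_eq, tsum_fintype, ← Finset.sum_subset (Finset.subset_univ (targets m))]
  · refine Finset.sum_le_sum fun T hT => mul_le_mul' (le_of_eq ?_) ?_
    · exact targetLaw_of_mem hm hT
    · calc ∑' V, winnerLaw w T V * f (next w T V) ≤ ∑' V, winnerLaw w T V * G T := by
            refine ENNReal.tsum_le_tsum fun V => ?_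
            by_cases hV : IsValidWinner w T V
            · exact mul_le_mul' le_rfl (h T hT V hV)
            · simp [winnerLaw_eq_zero w T V hV]
        _ = G T := by rw [ENNReal.tsum_mul_right, PMF.tsum_coe, one_mul]
  · intro T _ hT
    rw [targetLaw_of_notMem hm hT, zero_mul]

lemma stepExpect_le_ofReal {m : ℕ} (hm : 2 ≤ m) (f : Config m → ℝ≥0∞) (w : Config m)
    (g : (Fin m → Fin m) → ℝ) (hg : ∀ T ∈ targets m, 0 ≤ g T)
    (h : ∀ T ∈ targets m, ∀ V, IsValidWinner w T V → f (next w T V) ≤ ENNReal.ofReal (g T)) :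
    stepExpect hm f w ≤
      ENNReal.ofReal ((((targets m).card : ℝ))⁻¹ * ∑ T ∈ targets m, g T) := by
  refine (stepExpect_le hm f w _ h).trans (le_of_eq ?_)
  have hpos : 0 < (targets m).card := by
    rw [card_targets]; exact pow_pos (by omega) _
  rw [← card_targets, ← Finset.mul_sum, ENNReal.ofReal_mul (by positivity),
    ENNReal.ofReal_sum_of_nonneg hg, ENNReal.ofReal_inv_of_pos (by exact_mod_cast hpos),
    ENNReal.ofReal_natCast]

lemma stepExpect_mono {m : ℕ} (hm : 2 ≤ m) (f g : Config m → ℝ≥0∞) (w : Config m)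
    (h : ∀ T ∈ targets m, ∀ V, IsValidWinner w T V → f (next w T V) ≤ g (next w T V)) :
    stepExpect hm f w ≤ stepExpect hm g w := by
  rw [stepExpect_eq, stepExpect_eq]
  refine ENNReal.tsum_le_tsum fun T => ?_
  by_cases hT : T ∈ targets m
  · refine mul_le_mul' le_rfl (ENNReal.tsum_le_tsum fun V => ?_)
    by_cases hV : IsValidWinner w T V
    · exact mul_le_mul' le_rfl (h T hT V hV)
    · simp [winnerLaw_eq_zero w T V hV]
  · rw [targetLaw_of_notMem hm hT, zero_mul]
    exact zero_le

/-! ### Work and potential after one slot -/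

/-- A sum over the queues after one time slot, in terms of the queues before it. -/
lemma sum_next {m : ℕ} (w : Config m) (T V : Fin m → Fin m) (hV : IsValidWinner w T V)
    (φ : ℕ → ℝ) (hφ : φ 0 = 0) :
    ∑ i, φ (next w T V i) =
      ∑ i, if (requesters w T i).Nonempty
        then φ ((w i - 1) - (w i - 1) / 2) + φ ((w i - 1) / 2) else φ (w i - 1) := by
  -- The tasks obtained by a thief `i` are written as a sum over the queues `k` that serve `i`.
  -- Exchanging the sums charges the stolen half to its victim, and the winners disappear. Queues
  -- with `w k ≤ 1` may be included, since `(w k - 1) / 2 = 0` and `φ 0 = 0`.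
  have h1 : ∀ i, φ (next w T V i) =
      (if (requesters w T i).Nonempty then φ ((w i - 1) - (w i - 1) / 2) else φ (w i - 1)) +
        ∑ k, if (requesters w T k).Nonempty ∧ V k = i then φ ((w k - 1) / 2) else 0 := by
    intro i
    by_cases hi : w i = 0
    · have hz : (if (requesters w T i).Nonempty then φ ((w i - 1) - (w i - 1) / 2)
          else φ (w i - 1)) = 0 := by simp [hi, hφ]
      rw [hz, zero_add, Finset.sum_eq_single (T i)]
      · have hne : (requesters w T (T i)).Nonempty := ⟨i, by simp [requesters, hi]⟩
        by_cases hVi : V (T i) = i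
        · by_cases h2 : 2 ≤ w (T i)
          · simp [next, hi, hne, hVi, h2]
          · simp [next, hi, hne, hVi, h2, hφ, show (w (T i) - 1) / 2 = 0 by omega]
        · simp [next, hi, hVi, hφ]
      · intro k _ hk
        rw [if_neg]
        rintro ⟨hne, hVk⟩
        have := hV k hne
        simp only [requesters, Finset.mem_filter, hVk] at this
        exact hk this.2.2.symm
      · simp
    · rw [Finset.sum_eq_zero, add_zero]
      · by_cases h2 : 2 ≤ w i
        · by_cases hne : (requesters w T i).Nonempty <;> simp [next, hi, h2, hne]
        · have : w i = 1 := by omega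
          simp [next, this]
      · intro k _
        rw [if_neg]
        rintro ⟨hne, hVk⟩
        have := hV k hne
        simp only [requesters, Finset.mem_filter, hVk] at this
        exact hi this.2.1
  rw [Finset.sum_congr rfl fun i _ => h1 i, Finset.sum_add_distrib, Finset.sum_comm,
    ← Finset.sum_add_distrib]
  refine Finset.sum_congr rfl fun k _ => ?_
  by_cases hne : (requesters w T k).Nonempty <;> simp [hne]

/-- The number of idle processors. -/
def idleCount {m : ℕ} (w : Config m) : ℕ := (Finset.univ.filter fun i => w i = 0).card

lemma idleCount_le {m : ℕ} (w : Config m) : idleCount w ≤ m := by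
  simpa [idleCount] using Finset.card_filter_le Finset.univ fun i => w i = 0

lemma sum_pred_add {m : ℕ} (w : Config m) :
    ((∑ i, ((w i - 1 : ℕ) : ℝ)) + m = totalWork w + idleCount w) := by
  have h : ∀ i, ((w i - 1 : ℕ) : ℝ) + 1 = w i + if w i = 0 then 1 else 0 := by
    intro i
    by_cases hi : w i = 0
    · simp [hi]
    · rw [if_neg hi, Nat.cast_sub (by omega)]; simp
  have := Finset.sum_congr rfl fun i (_ : i ∈ Finset.univ) => h i
  rw [Finset.sum_add_distrib, Finset.sum_add_distrib] at this
  simpa [totalWork, idleCount] using this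

lemma totalWork_next {m : ℕ} (w : Config m) (T V : Fin m → Fin m) (hV : IsValidWinner w T V) :
    (totalWork (next w T V) : ℝ) = ∑ i, ((w i - 1 : ℕ) : ℝ) := by
  rw [totalWork, Nat.cast_sum, sum_next w T V hV (fun n => (n : ℝ)) Nat.cast_zero]
  refine Finset.sum_congr rfl fun i _ => ?_
  split_ifs
  · rw [← Nat.cast_add, Nat.sub_add_cancel (Nat.div_le_self _ _)]
  · rfl

lemma totalWork_next_add {m : ℕ} (w : Config m) (T V : Fin m → Fin m) (hV : IsValidWinner w T V) :
    (totalWork (next w T V) : ℝ) + m = totalWork w + idleCount w := by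
  rw [totalWork_next w T V hV, sum_pred_add]

lemma potential_eq {m : ℕ} (hm : m ≠ 0) (w : Config m) :
    potential w = ∑ i, (w i : ℝ) ^ 2 - (totalWork w : ℝ) ^ 2 / m := by
  have h : ∀ i, ((w i : ℝ) - (totalWork w : ℝ) / m) ^ 2 =
      (w i : ℝ) ^ 2 - 2 * (totalWork w / m) * w i + (totalWork w / m) ^ 2 := fun i => by ring
  rw [potential, Finset.sum_congr rfl fun i _ => h i, Finset.sum_add_distrib,
    Finset.sum_sub_distrib, ← Finset.mul_sum, Finset.sum_const, Finset.card_univ, Fintype.card_fin,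
    nsmul_eq_mul, show ∑ i, (w i : ℝ) = totalWork w by simp [totalWork]]
  have : (m : ℝ) ≠ 0 := by exact_mod_cast hm
  field_simp
  ring

lemma potential_nonneg {m : ℕ} (w : Config m) : 0 ≤ potential w :=
  Finset.sum_nonneg fun _ _ => sq_nonneg _

/-- The parity bit is the loss due to rounding; it is what `mean_potential_le` has to absorb. -/
lemma half_sq_add_sq (n : ℕ) :
    ((n - n / 2 : ℕ) : ℝ) ^ 2 + ((n / 2 : ℕ) : ℝ) ^ 2 =
      (n : ℝ) ^ 2 - ((n : ℝ) ^ 2 - (n % 2 : ℕ)) / 2 := by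
  obtain ⟨k, hk | hk⟩ := Nat.even_or_odd' n
  · rw [show n - n / 2 = k by omega, show n / 2 = k by omega, show n % 2 = 0 by omega, hk]
    push_cast; ring
  · rw [show n - n / 2 = k + 1 by omega, show n / 2 = k by omega, show n % 2 = 1 by omega, hk]
    push_cast; ring

lemma potential_next {m : ℕ} (hm : m ≠ 0) (w : Config m) (T V : Fin m → Fin m)
    (hV : IsValidWinner w T V) :
    potential (next w T V) =
      ∑ i, (((w i - 1 : ℕ) : ℝ) ^ 2 - (if (requesters w T i).Nonempty then 1 else 0) *
        ((((w i - 1 : ℕ) : ℝ) ^ 2 - ((w i - 1) % 2 : ℕ)) / 2)) -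
        (∑ i, ((w i - 1 : ℕ) : ℝ)) ^ 2 / m := by
  rw [potential_eq hm, totalWork_next w T V hV,
    sum_next w T V hV (fun n => (n : ℝ) ^ 2) (by simp)]
  congr 1
  refine Finset.sum_congr rfl fun i _ => ?_
  split_ifs
  · rw [half_sq_add_sq]; ring
  · ring

/-! ### Expected decrease of the potential -/

/-- The probability that a given active processor receives a request. -/
noncomputable def requestProb {m : ℕ} (w : Config m) : ℝ :=
  1 - (((m : ℝ) - 2) / (m - 1)) ^ idleCount w

/-- Queue `i` is missed when every idle `j` avoids it, which leaves `j` with `m - 2` of its `m - 1`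
choices. This count uses that `i` is active, hence different from `j`. -/
lemma mean_requesters_nonempty {m : ℕ} (hm : 2 ≤ m) (w : Config m) (i : Fin m) (hi : w i ≠ 0) :
    ((targets m).card : ℝ)⁻¹ *
      ∑ T ∈ targets m, (if (requesters w T i).Nonempty then (1 : ℝ) else 0) = requestProb w := by
  have h1 : (targets m).filter (fun T => ¬ (requesters w T i).Nonempty) =
      Fintype.piFinset fun j => if w j = 0 then (Finset.univ.erase j).erase i
        else Finset.univ.erase j := by
    ext T
    simp only [targets, Finset.mem_filter, Fintype.mem_piFinset, Finset.not_nonempty_iff_eq_empty,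
      requesters, Finset.filter_eq_empty_iff, Finset.mem_univ, true_implies]
    constructor
    · rintro ⟨hT, hr⟩ j
      split_ifs with hj
      · exact Finset.mem_erase.mpr ⟨fun h => hr ⟨hj, h⟩, hT j⟩
      · exact hT j
    · intro h
      refine ⟨fun j => ?_, fun j hj => ?_⟩
      · have := h j
        split_ifs at this
        · exact Finset.mem_of_mem_erase this
        · exact this
      · have := h j
        rw [if_pos hj.1] at this
        exact (Finset.mem_erase.mp this).1 hj.2
  have h2 : ((targets m).filter (fun T => ¬ (requesters w T i).Nonempty)).card =
      (m - 2) ^ idleCount w * (m - 1) ^ (m - idleCount w) := by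
    rw [h1, Fintype.card_piFinset]
    have : ∀ j, (if w j = 0 then (Finset.univ.erase j).erase i
        else Finset.univ.erase j).card = if w j = 0 then m - 2 else m - 1 := by
      intro j
      split_ifs with hj
      · rw [Finset.card_erase_of_mem, Finset.card_erase_of_mem (Finset.mem_univ _),
          Finset.card_univ, Fintype.card_fin]
        · omega
        · refine Finset.mem_erase.mpr ⟨fun h => hi (h ▸ hj), Finset.mem_univ _⟩
      · simp
    rw [Finset.prod_congr rfl fun j _ => this j, Finset.prod_ite, Finset.prod_const,
      Finset.prod_const, idleCount]
    congr 2
    have := Finset.card_filter_add_card_filter_not (s := (Finset.univ : Finset (Fin m)))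
      (p := fun j => w j = 0)
    rw [Finset.card_univ, Fintype.card_fin] at this
    omega
  have h3 := Finset.card_filter_add_card_filter_not (s := targets m)
    (p := fun T => (requesters w T i).Nonempty)
  have h4 : (∑ T ∈ targets m, (if (requesters w T i).Nonempty then (1 : ℝ) else 0)) =
      (targets m).card - (m - 2 : ℕ) ^ idleCount w * (m - 1 : ℕ) ^ (m - idleCount w) := by
    rw [Finset.sum_boole, ← h3, h2]
    push_cast
    ring
  have hr := idleCount_le w
  rw [h4, card_targets, requestProb]
  have hpos : (0 : ℝ) < (m : ℝ) - 1 := by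
    have : (2 : ℝ) ≤ m := by exact_mod_cast hm
    linarith
  push_cast [Nat.cast_sub hm, Nat.cast_sub (show 1 ≤ m by omega)]
  rw [div_pow, mul_sub, inv_mul_cancel₀ (by positivity)]
  congr 1
  rw [inv_mul_eq_div, div_eq_div_iff (by positivity) (by positivity), mul_assoc, ← pow_add,
    Nat.sub_add_cancel hr]

lemma requestProb_mem {m : ℕ} (hm : 2 ≤ m) (w : Config m) :
    0 ≤ requestProb w ∧ requestProb w ≤ 1 ∧ requestProb w * (m - 1) ≤ idleCount w := by
  have h2 : (2 : ℝ) ≤ m := by exact_mod_cast hm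
  have hpos : (0 : ℝ) < (m : ℝ) - 1 := by linarith
  have hq : 0 ≤ ((m : ℝ) - 2) / (m - 1) := div_nonneg (by linarith) hpos.le
  refine ⟨sub_nonneg.mpr (pow_le_one₀ hq ?_), ?_, ?_⟩
  · rw [div_le_one hpos]; linarith
  · rw [requestProb]; have := pow_nonneg hq (idleCount w); linarith
  -- Bernoulli's inequality, which here is the union bound over the idle processors.
  · have hb := one_add_mul_le_pow (a := -(1 / ((m : ℝ) - 1))) (by
      have : 1 / ((m : ℝ) - 1) ≤ 1 := by rw [div_le_one hpos]; linarith
      linarith) (idleCount w)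
    have he : (1 : ℝ) + -(1 / ((m : ℝ) - 1)) = (m - 2) / (m - 1) := by field_simp; ring
    rw [he] at hb
    have : requestProb w ≤ idleCount w * (1 / ((m : ℝ) - 1)) := by rw [requestProb]; linarith
    calc requestProb w * (m - 1) ≤ idleCount w * (1 / ((m : ℝ) - 1)) * (m - 1) :=
          mul_le_mul_of_nonneg_right this hpos.le
      _ = idleCount w := by field_simp

/-- The mean of the potential after one time slot, up to the parity of the queues. -/
lemma mean_potential_le {m : ℕ} (hm : 2 ≤ m) (w : Config m) :
    (1 - requestProb w / 2) * ∑ i, ((w i - 1 : ℕ) : ℝ) ^ 2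
      + requestProb w / 2 * ∑ i, (((w i - 1) % 2 : ℕ) : ℝ) - (∑ i, ((w i - 1 : ℕ) : ℝ)) ^ 2 / m ≤
    (1 - requestProb w / 2) * potential w := by
  obtain ⟨hp0, hp1, hp⟩ := requestProb_mem hm w
  have hm2 : (2 : ℝ) ≤ m := by exact_mod_cast hm
  have hr : (idleCount w : ℝ) ≤ m := by exact_mod_cast idleCount_le w
  have hW := sum_pred_add w
  have hsq : ∑ i, (w i : ℝ) ^ 2 =
      ∑ i, ((w i - 1 : ℕ) : ℝ) ^ 2 + 2 * ∑ i, ((w i - 1 : ℕ) : ℝ) + m - idleCount w := by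
    have h : ∀ i, (w i : ℝ) ^ 2 = ((w i - 1 : ℕ) : ℝ) ^ 2 + 2 * ((w i - 1 : ℕ) : ℝ) + 1 -
        if w i = 0 then 1 else 0 := by
      intro i
      by_cases hi : w i = 0
      · simp [hi]
      · rw [if_neg hi, Nat.cast_sub (by omega)]; push_cast; ring
    rw [Finset.sum_congr rfl fun i _ => h i, Finset.sum_sub_distrib, Finset.sum_add_distrib,
      Finset.sum_add_distrib, Finset.mul_sum]
    simp [idleCount]
  have hO1 : ∑ i, (((w i - 1) % 2 : ℕ) : ℝ) ≤ ∑ i, ((w i - 1 : ℕ) : ℝ) :=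
    Finset.sum_le_sum fun i _ => by exact_mod_cast Nat.mod_le _ _
  have hO2 : ∑ i, (((w i - 1) % 2 : ℕ) : ℝ) ≤ m - idleCount w := by
    have h : ∀ i, (((w i - 1) % 2 : ℕ) : ℝ) ≤ 1 - if w i = 0 then 1 else 0 := by
      intro i
      by_cases hi : w i = 0
      · simp [hi]
      · rw [if_neg hi, sub_zero]
        have : (w i - 1) % 2 ≤ 1 := by omega
        exact_mod_cast this
    refine (Finset.sum_le_sum fun i _ => h i).trans (le_of_eq ?_)
    simp [idleCount]
  have hO0 : 0 ≤ ∑ i, (((w i - 1) % 2 : ℕ) : ℝ) := Finset.sum_nonneg fun _ _ => Nat.cast_nonneg _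
  have hV0 : 0 ≤ ∑ i, ((w i - 1 : ℕ) : ℝ) := Finset.sum_nonneg fun _ _ => Nat.cast_nonneg _
  have hr0 : (0 : ℝ) ≤ idleCount w := Nat.cast_nonneg _
  rw [potential_eq (by omega), hsq, show (totalWork w : ℝ) = ∑ i, ((w i - 1 : ℕ) : ℝ) + m -
    idleCount w by linarith]
  set S := ∑ i, ((w i - 1 : ℕ) : ℝ) ^ 2
  set V := ∑ i, ((w i - 1 : ℕ) : ℝ)
  set O := ∑ i, (((w i - 1) % 2 : ℕ) : ℝ)
  set p := requestProb w
  set r : ℝ := (idleCount w : ℝ)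
  set μ : ℝ := (m : ℝ)
  have hμ : 0 < μ := by linarith
  -- The parity term `p μ O / 2` is at most `r O`, because `p (μ - 1) ≤ r` and `μ ≤ 2 (μ - 1)`. The
  -- gain from idle processors is at least `r (2 V + μ - r) / 2 ≥ (3/2) r O`, because `O ≤ V` and `O
  -- ≤ μ - r`.
  have e1 : p * (μ - 1) * O ≤ r * O := mul_le_mul_of_nonneg_right hp hO0
  have e2 : p * μ ≤ 2 * (p * (μ - 1)) := by nlinarith
  have e3 : p * μ * O ≤ 2 * (r * O) := by nlinarith
  have e4 : r * (3 * O) ≤ r * (2 * V + (μ - r)) := mul_le_mul_of_nonneg_left (by linarith) hr0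
  have e5 : 0 ≤ r * (2 * V + (μ - r)) := mul_nonneg hr0 (by linarith)
  have e6 : (1 / 2) * (r * (2 * V + (μ - r))) ≤ (1 - p / 2) * (r * (2 * V + (μ - r))) :=
    mul_le_mul_of_nonneg_right (by linarith) e5
  have e7 : 0 ≤ r * O := mul_nonneg hr0 hO0
  have key : 0 ≤ (p / 2 * V ^ 2 + (1 - p / 2) * (r * (2 * V + (μ - r))) - p / 2 * (O * μ)) / μ := by
    refine div_nonneg ?_ hμ.le
    have : 0 ≤ p / 2 * V ^ 2 := by positivity
    nlinarith
  have hid : (1 - p / 2) * (S + 2 * V + μ - r - (V + μ - r) ^ 2 / μ) -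
      ((1 - p / 2) * S + p / 2 * O - V ^ 2 / μ) =
      (p / 2 * V ^ 2 + (1 - p / 2) * (r * (2 * V + (μ - r))) - p / 2 * (O * μ)) / μ := by
    field_simp
    ring
  linarith

lemma stepExpect_potential_le_requestProb {m : ℕ} (hm : 2 ≤ m) (w : Config m) :
    stepExpect hm (fun w' => ENNReal.ofReal (potential w')) w ≤
      ENNReal.ofReal ((1 - requestProb w / 2) * potential w) := by
  have hm0 : m ≠ 0 := by omega
  refine (stepExpect_le_ofReal hm _ w (fun T => ∑ i, (((w i - 1 : ℕ) : ℝ) ^ 2 -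
    (if (requesters w T i).Nonempty then 1 else 0) *
        ((((w i - 1 : ℕ) : ℝ) ^ 2 - ((w i - 1) % 2 : ℕ)) / 2)) -
        (∑ i, ((w i - 1 : ℕ) : ℝ)) ^ 2 / m) ?_ ?_).trans (ENNReal.ofReal_le_ofReal ?_)
  · intro T _
    obtain ⟨V, hV⟩ := exists_isValidWinner w T
    rw [← potential_next hm0 w T V hV]
    exact potential_nonneg _
  · intro T _ V hV
    rw [potential_next hm0 w T V hV]
  · refine le_trans (le_of_eq ?_) (mean_potential_le hm w)
    have hN : ((targets m).card : ℝ) ≠ 0 := by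
      rw [card_targets]; exact_mod_cast (pow_pos (by omega) _).ne'
    rw [Finset.sum_sub_distrib, Finset.sum_const, nsmul_eq_mul, mul_sub, inv_mul_cancel_left₀ hN]
    congr 1
    rw [Finset.sum_comm, Finset.mul_sum, Finset.mul_sum, Finset.mul_sum,
      ← Finset.sum_add_distrib]
    refine Finset.sum_congr rfl fun i _ => ?_
    rw [Finset.sum_sub_distrib, Finset.sum_const, nsmul_eq_mul, ← Finset.sum_mul, mul_sub,
      inv_mul_cancel_left₀ hN, ← mul_assoc]
    -- An idle `i` contributes nothing, as `w i - 1` truncates to `0`; only active queues need the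
    -- value `requestProb w`.
    by_cases hi : w i = 0
    · simp [hi]
    · rw [mean_requesters_nonempty hm w i hi]; ring

/-! ### The constant `lam` and the decay rate -/

/-- The fraction is `33/73 = 1 - 2/3.65`, exactly what `2 * lam < 3.65` requires. -/
lemma logb_one_add_inv_exp_lt : Real.logb 2 (1 + 1 / Real.exp 1) < 33 / 73 := by
  have he := Real.exp_one_gt_d9
  have h0 : (0 : ℝ) < 1 / Real.exp 1 := by positivity
  have h1 : 1 + 1 / Real.exp 1 < 1.36787946 := by
    have : 1 / Real.exp 1 < 1 / 2.7182818283 := one_div_lt_one_div_of_lt (by norm_num) he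
    refine (add_lt_add_right this 1).trans (by norm_num)
  have h2 : (1 + 1 / Real.exp 1) ^ 73 < (2 : ℝ) ^ 33 :=
    (pow_lt_pow_left₀ h1 (by positivity) (by norm_num)).trans (by norm_num)
  have h3 := Real.logb_lt_logb (b := 2) (by norm_num) (by positivity) h2
  rw [Real.logb_pow, Real.logb_pow, Real.logb_self_eq_one (by norm_num)] at h3
  push_cast at h3
  linarith

/-- Ensures that the factor `2 ^ (-ρ/lam)` of a single slot is at least `1/2`, which the inductions
on time need. -/
lemma one_lt_lam : 1 < lam := by
  have h := logb_one_add_inv_exp_lt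
  have h0 : 0 < Real.logb 2 (1 + 1 / Real.exp 1) :=
    Real.logb_pos (by norm_num) (by have : 0 < 1 / Real.exp 1 := by positivity
                                    linarith)
  rw [lam, lt_div_iff₀ (by linarith)]
  linarith

lemma two_mul_lam_lt : 2 * lam < 3.65 := by
  have h := logb_one_add_inv_exp_lt
  have : lam < 1 / (40 / 73) := one_div_lt_one_div_of_lt (by norm_num) (by linarith)
  norm_num at this ⊢
  linarith

lemma two_rpow_neg_inv_lam : (2 : ℝ) ^ (-(1 / lam)) = (1 + Real.exp (-1)) / 2 := by
  have h1 : -(1 / lam) = Real.logb 2 (1 + 1 / Real.exp 1) - 1 := by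
    rw [lam, one_div_one_div]; ring
  rw [h1, Real.rpow_sub_one (by norm_num), Real.rpow_logb (by norm_num) (by norm_num)
    (by positivity), Real.exp_neg, one_div]

/-- Two-term Hölder inequality against the constant `2`. -/
lemma one_add_rpow_le {c x : ℝ} (hc : 0 < c) (hx0 : 0 ≤ x) (hx1 : x ≤ 1) :
    (1 + c ^ x) / 2 ≤ ((1 + c) / 2) ^ x := by
  -- Both terms are normalised by `2/(1+c)`, so that the bases `2/(1+c)` and `2c/(1+c)` add up to
  -- `2`, and the two arithmetic means add up to `2` as well.
  have a1 := Real.geom_mean_le_arith_mean2_weighted (w₁ := 1 - x) (w₂ := x) (p₁ := 1)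
    (p₂ := 2 / (1 + c)) (by linarith) hx0 zero_le_one (by positivity) (by ring)
  have a2 := Real.geom_mean_le_arith_mean2_weighted (w₁ := 1 - x) (w₂ := x) (p₁ := 1)
    (p₂ := c * (2 / (1 + c))) (by linarith) hx0 zero_le_one (by positivity) (by ring)
  rw [Real.one_rpow, one_mul] at a1 a2
  rw [Real.mul_rpow hc.le (by positivity)] at a2
  have h : ((1 + c) / 2) ^ x * (2 / (1 + c)) ^ x = 1 := by
    rw [← Real.mul_rpow (by positivity) (by positivity),
      show (1 + c) / 2 * (2 / (1 + c)) = 1 by field_simp, Real.one_rpow]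
  have hs : (1 + c ^ x) * (2 / (1 + c)) ^ x ≤ 2 := by
    have : x * (2 / (1 + c)) + x * (c * (2 / (1 + c))) = 2 * x := by field_simp
    nlinarith
  have hpos : 0 < ((1 + c) / 2) ^ x := by positivity
  nlinarith

lemma one_sub_requestProb_le {m : ℕ} (hm : 2 ≤ m) (w : Config m) :
    1 - requestProb w / 2 ≤ (2 : ℝ) ^ (-((idleCount w : ℝ) / m / lam)) := by
  have hm2 : (2 : ℝ) ≤ m := by exact_mod_cast hm
  have hr : (idleCount w : ℝ) ≤ m := by exact_mod_cast idleCount_le w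
  have hr0 : (0 : ℝ) ≤ idleCount w := Nat.cast_nonneg _
  set x : ℝ := (idleCount w : ℝ) / m
  have hx0 : 0 ≤ x := by positivity
  have hx1 : x ≤ 1 := div_le_one_of_le₀ hr (by linarith)
  have h1 : (((m : ℝ) - 2) / (m - 1)) ^ idleCount w ≤ Real.exp (-1) ^ x := by
    -- Here `(m-2)/(m-1) ≤ 1 - 1/m ≤ e^(-1/m)`.
    have hb : ((m : ℝ) - 2) / (m - 1) ≤ Real.exp (-(1 / (m : ℝ))) := by
      refine le_trans ?_ (Real.add_one_le_exp _)
      rw [div_le_iff₀ (by linarith)]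
      field_simp
      nlinarith
    refine (pow_le_pow_left₀ (div_nonneg (by linarith) (by linarith)) hb _).trans (le_of_eq ?_)
    rw [← Real.exp_nat_mul, ← Real.exp_mul]
    congr 1
    simp only [x]; ring
  have h2 := one_add_rpow_le (Real.exp_pos (-1)) hx0 hx1
  rw [show -(x / lam) = -(1 / lam) * x by ring, Real.rpow_mul (by norm_num), two_rpow_neg_inv_lam]
  refine le_trans ?_ h2
  rw [requestProb]
  linarith

lemma stepExpect_potential_le {m : ℕ} (hm : 2 ≤ m) (w : Config m) :
    stepExpect hm (fun w' => ENNReal.ofReal (potential w')) w ≤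
      ENNReal.ofReal ((2 : ℝ) ^ (-((idleCount w : ℝ) / m / lam)) * potential w) :=
  (stepExpect_potential_le_requestProb hm w).trans <| ENNReal.ofReal_le_ofReal <|
    mul_le_mul_of_nonneg_right (one_sub_requestProb_le hm w) (potential_nonneg w)

lemma stepExpect_affine_le {m : ℕ} (hm : 2 ≤ m) (w : Config m) {a b : ℝ} (ha : 0 ≤ a)
    (hb : 0 ≤ b) :
    stepExpect hm (fun w' => ENNReal.ofReal (a + b * potential w')) w ≤
      ENNReal.ofReal (a + b * ((2 : ℝ) ^ (-((idleCount w : ℝ) / m / lam)) * potential w)) := by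
  have h0 := potential_nonneg w
  have h1 : stepExpect hm (fun w' => ENNReal.ofReal (a + b * potential w')) w =
      ENNReal.ofReal a + ENNReal.ofReal b *
        stepExpect hm (fun w' => ENNReal.ofReal (potential w')) w := by
    simp only [stepExpect]
    rw [← ENNReal.tsum_mul_left]
    have : ENNReal.ofReal a = ∑' w', stepLaw hm w w' * ENNReal.ofReal a := by
      rw [ENNReal.tsum_mul_right, PMF.tsum_coe, one_mul]
    rw [this, ← ENNReal.tsum_add]
    refine tsum_congr fun w' => ?_
    rw [ENNReal.ofReal_add ha (mul_nonneg hb (potential_nonneg w')), ENNReal.ofReal_mul hb]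
    ring
  rw [h1, ENNReal.ofReal_add ha (by positivity), ENNReal.ofReal_mul hb]
  gcongr
  exact stepExpect_potential_le hm w

/-! ### Balanced configurations -/

/-- All queues have the same length, up to one task. -/
def Balanced {m : ℕ} (w : Config m) : Prop := ∀ i j, w i ≤ w j + 1

/-- Two terms of the sum suffice: `a² + b² ≥ (a - b)²/2`. As queue lengths are integers, this
separates the potential from `0`, and from `2` outside balanced configurations. -/
lemma half_sq_sub_le_potential {m : ℕ} (w : Config m) (i j : Fin m) :
    ((w i : ℝ) - w j) ^ 2 / 2 ≤ potential w := by
  have hle : ∀ k, ((w k : ℝ) - (totalWork w : ℝ) / m) ^ 2 ≤ potential w := fun k =>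
    Finset.single_le_sum (f := fun k => ((w k : ℝ) - (totalWork w : ℝ) / m) ^ 2)
      (fun _ _ => sq_nonneg _) (Finset.mem_univ k)
  by_cases hij : i = j
  · simpa [hij] using potential_nonneg w
  · have h := Finset.sum_le_univ_sum_of_nonneg (s := {i, j})
      (f := fun k => ((w k : ℝ) - (totalWork w : ℝ) / m) ^ 2) (fun _ => sq_nonneg _)
    rw [Finset.sum_pair hij] at h
    refine le_trans ?_ h
    nlinarith [sq_nonneg ((w i : ℝ) - (totalWork w : ℝ) / m + (w j - (totalWork w : ℝ) / m))]

lemma two_le_potential {m : ℕ} (w : Config m) (h : ¬ Balanced w) : 2 ≤ potential w := by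
  simp only [Balanced, not_forall, not_le] at h
  obtain ⟨i, j, hij⟩ := h
  have h2 : (w j : ℝ) + 2 ≤ w i := by exact_mod_cast hij
  have := half_sq_sub_le_potential w i j
  nlinarith

lemma half_le_potential {m : ℕ} (w : Config m) (h : 0 < potential w) : 1 / 2 ≤ potential w := by
  by_cases hw : ∀ i j, w i ≤ w j
  · exfalso
    by_cases hm : m = 0
    · subst hm; simp [potential] at h
    · refine h.ne' (Finset.sum_eq_zero fun i _ => ?_)
      have hc : totalWork w = m * w i := by
        rw [totalWork, Finset.sum_congr rfl fun j _ => le_antisymm (hw j i) (hw i j)]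
        simp
      have : (m : ℝ) ≠ 0 := by exact_mod_cast hm
      rw [hc]
      push_cast
      field_simp
      ring
  · simp only [not_forall, not_le] at hw
    obtain ⟨i, j, hij⟩ := hw
    have h2 : (w j : ℝ) + 1 ≤ w i := by exact_mod_cast hij
    have := half_sq_sub_le_potential w i j
    nlinarith

lemma Balanced.le_of_totalWork_le {m : ℕ} {w : Config m} (hw : Balanced w) {t : ℕ}
    (ht : totalWork w ≤ m * t) (i : Fin m) : w i ≤ t := by
  by_contra! h
  have h1 : ∑ _j : Fin m, t < totalWork w :=
    Finset.sum_lt_sum (fun j _ => by have := hw i j; omega) ⟨i, Finset.mem_univ i, h⟩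
  simp at h1
  omega

/-- A steal request requires an empty queue; then all the others hold at most one task, and the
request fails. -/
lemma Balanced.next {m : ℕ} {w : Config m} (hw : Balanced w) (T V : Fin m → Fin m) (i : Fin m) :
    next w T V i = w i - 1 := by
  by_cases hi : w i = 0
  · have := hw (T i) i
    rw [DLS.next, if_pos hi, if_neg (by omega), hi]
  · by_cases hr : (requesters w T i).Nonempty
    · obtain ⟨j, hj⟩ := hr
      simp only [requesters, Finset.mem_filter] at hj
      have := hw i j
      rw [DLS.next, if_neg hi, if_neg (by omega)]
    · rw [DLS.next, if_neg hi, if_neg (by tauto)]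

lemma stepExpect_eq_zero {m : ℕ} (hm : 2 ≤ m) (f : Config m → ℝ≥0∞) (w : Config m)
    (h : ∀ T V, f (next w T V) = 0) : stepExpect hm f w = 0 := by
  simp [stepExpect_eq, h]

lemma Balanced.aliveProb_eq_zero_of_le {m : ℕ} (hm : 2 ≤ m) {w : Config m} (hw : Balanced w)
    {t : ℕ} (ht : ∀ i, w i ≤ t) : aliveProb hm t w = 0 := by
  induction t generalizing w with
  | zero =>
    have : w = 0 := funext fun i => Nat.le_zero.mp (ht i)
    rw [aliveProb_zero, if_pos this]
  | succ t ih =>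
    rw [aliveProb_succ]
    refine stepExpect_eq_zero hm _ w fun T V => ih (fun i j => ?_) fun i => ?_
    · have := hw i j
      rw [hw.next, hw.next]; omega
    · have := ht i
      rw [hw.next]; omega

lemma Balanced.aliveProb_eq_zero {m : ℕ} (hm : 2 ≤ m) {w : Config m} (hw : Balanced w)
    {t : ℕ} (ht : (totalWork w : ℝ) / m ≤ t) : aliveProb hm t w = 0 := by
  refine hw.aliveProb_eq_zero_of_le hm (hw.le_of_totalWork_le ?_)
  rw [div_le_iff₀ (by exact_mod_cast (by omega : 0 < m)), mul_comm] at ht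
  exact_mod_cast ht

lemma Balanced.sum_aliveProb_le {m : ℕ} (hm : 2 ≤ m) {w : Config m} (hw : Balanced w) (n : ℕ) :
    ∑ t ∈ Finset.range n, aliveProb hm t w ≤ ENNReal.ofReal ((totalWork w : ℝ) / m + 1) := by
  set N := ⌈(totalWork w : ℝ) / m⌉₊
  have h1 : ∑ t ∈ Finset.range n, aliveProb hm t w ≤
      ∑ t ∈ Finset.range n, if t ∈ Finset.range N then 1 else 0 := by
    refine Finset.sum_le_sum fun t _ => ?_
    split_ifs with h
    · exact aliveProb_le_one hm t w
    · rw [hw.aliveProb_eq_zero hm]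
      exact (Nat.le_ceil _).trans (by exact_mod_cast not_lt.mp (mt Finset.mem_range.mpr h))
  refine h1.trans ?_
  rw [← Finset.sum_filter, Finset.sum_const, nsmul_one, ← ENNReal.ofReal_natCast]
  refine ENNReal.ofReal_le_ofReal ?_
  refine le_trans ?_ (Nat.ceil_lt_add_one (show 0 ≤ (totalWork w : ℝ) / m by positivity)).le
  refine Nat.cast_le.mpr ?_
  calc _ ≤ (Finset.range N).card := Finset.card_le_card fun t ht => (Finset.mem_filter.mp ht).2
    _ = N := Finset.card_range N

/-! ### Induction on time: tail and mean -/

lemma stepExpect_sum {m : ℕ} (hm : 2 ≤ m) (f : ℕ → Config m → ℝ≥0∞) (n : ℕ) (w : Config m) :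
    ∑ t ∈ Finset.range n, stepExpect hm (f t) w =
      stepExpect hm (fun w' => ∑ t ∈ Finset.range n, f t w') w := by
  simp only [stepExpect, Finset.mul_sum]
  rw [Summable.tsum_finsetSum fun _ _ => ENNReal.summable]

lemma sum_range_succ_aliveProb {m : ℕ} (hm : 2 ≤ m) (n : ℕ) (w : Config m) :
    ∑ t ∈ Finset.range (n + 1), aliveProb hm t w = aliveProb hm 0 w +
      stepExpect hm (fun w' => ∑ t ∈ Finset.range n, aliveProb hm t w') w := by
  rw [Finset.sum_range_succ', add_comm, ← stepExpect_sum]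
  simp only [aliveProb_succ]

lemma idleCount_div_mem {m : ℕ} (hm : 2 ≤ m) (w : Config m) :
    0 ≤ (idleCount w : ℝ) / m ∧ (idleCount w : ℝ) / m ≤ 1 := by
  have hr : (idleCount w : ℝ) ≤ m := by exact_mod_cast idleCount_le w
  exact ⟨by positivity, div_le_one_of_le₀ hr (by positivity)⟩

lemma totalWork_next_div {m : ℕ} (hm : 2 ≤ m) (w : Config m) (T V : Fin m → Fin m)
    (hV : IsValidWinner w T V) :
    (totalWork (next w T V) : ℝ) / m = totalWork w / m - 1 + idleCount w / m := by
  have hm0 : (m : ℝ) ≠ 0 := by exact_mod_cast (by omega : m ≠ 0)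
  have := totalWork_next_add w T V hV
  field_simp
  linarith

lemma totalWork_div_nonneg {m : ℕ} (hm : 2 ≤ m) (w : Config m) :
    0 ≤ (totalWork w : ℝ) / m - 1 + idleCount w / m := by
  -- The quantity is `W/m` for a successor configuration. Any targets will do, even the identity,
  -- which is not an admissible draw.
  obtain ⟨V, hV⟩ := exists_isValidWinner w id
  rw [← totalWork_next_div hm w id V hV]
  positivity

/-- Here `x` is the number of slots allowed beyond `W/m`. A slot with idle fraction `ρ` uses up `ρ`
of it, and the factor `2 ^ (-ρ/lam)` gained on the potential restores the exponent. -/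
lemma aliveProb_le {m : ℕ} (hm : 2 ≤ m) (t : ℕ) (w : Config m) (x : ℝ) (hx : 0 ≤ x)
    (ht : (totalWork w : ℝ) / m + x ≤ t) :
    aliveProb hm t w ≤ ENNReal.ofReal (potential w * (2 : ℝ) ^ (-(x / lam))) := by
  have hl := one_lt_lam
  induction t generalizing w x with
  | zero =>
    have hW : 0 ≤ (totalWork w : ℝ) / m := by positivity
    have h0 : (totalWork w : ℝ) / m ≤ (0 : ℕ) := by push_cast at ht ⊢; linarith
    have hw : ∀ i, w i = 0 := by
      rw [div_le_iff₀ (by exact_mod_cast (by omega : 0 < m))] at h0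
      have : totalWork w = 0 := by simpa using h0
      simpa [totalWork] using this
    have : w = 0 := funext hw
    rw [aliveProb_zero, if_pos this]
    exact zero_le
  | succ t ih =>
    by_cases hw : Balanced w
    · rw [hw.aliveProb_eq_zero hm (by linarith)]
      exact zero_le
    have h2 := two_le_potential w hw
    -- When the bound is below `1`, `potential w ≥ 2` forces `x ≥ 1 ≥ ρ`, so the remaining allowance
    -- `x'` is nonnegative.
    by_cases hbig : 1 ≤ potential w * (2 : ℝ) ^ (-(x / lam))
    · exact (aliveProb_le_one hm _ w).trans (ENNReal.one_le_ofReal.mpr hbig)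
    obtain ⟨hr0, hr1⟩ := idleCount_div_mem hm w
    have hx1 : 1 ≤ x := by
      by_contra! hlt
      apply hbig
      have : (2 : ℝ) ^ (-1 : ℝ) ≤ (2 : ℝ) ^ (-(x / lam)) := by
        refine Real.rpow_le_rpow_of_exponent_le (by norm_num) (neg_le_neg ?_)
        rw [div_le_one (by linarith)]; linarith
      rw [Real.rpow_neg_one] at this
      nlinarith
    set x' : ℝ := x - idleCount w / m
    have hpos : 0 < (2 : ℝ) ^ (-(x' / lam)) := by positivity
    rw [aliveProb_succ]
    calc stepExpect hm (aliveProb hm t) w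
        ≤ stepExpect hm
          (fun w' => ENNReal.ofReal (0 + (2 : ℝ) ^ (-(x' / lam)) * potential w')) w := by
          refine stepExpect_mono hm _ _ w fun T _ V hV => ?_
          rw [zero_add, mul_comm]
          refine ih _ x' (by simp only [x']; linarith) ?_
          rw [totalWork_next_div hm w T V hV]
          push_cast at ht
          simp only [x']
          linarith
      _ ≤ _ := stepExpect_affine_le hm w le_rfl hpos.le
      _ = _ := by
          congr 1
          rw [zero_add, ← mul_assoc, ← Real.rpow_add (by norm_num), mul_comm]
          congr 2
          simp only [x']
          ring

/-- The induction hypothesis is applied at `y * δ`, with `δ = 2 ^ (-ρ/lam)` known before the draws.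
In the affine term this cancels the decay `δ` of the potential, while `lam * logb 2 (y * δ)` drops
by `ρ`, the amount by which `W/m` fails to decrease. The condition `2 ≤ y` keeps `y * δ ≥ 1`. -/
lemma sum_aliveProb_le_of_not_balanced {m : ℕ} (hm : 2 ≤ m) (n : ℕ) (w : Config m) (y : ℝ)
    (hy : 2 ≤ y)
    (ih : ∀ (w : Config m) (y : ℝ), 1 ≤ y → ∑ t ∈ Finset.range n, aliveProb hm t w ≤
      ENNReal.ofReal ((totalWork w : ℝ) / m + 1
        + lam * (Real.logb 2 y + potential w / (y * Real.log 2)))) :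
    ∑ t ∈ Finset.range (n + 1), aliveProb hm t w ≤
      ENNReal.ofReal ((totalWork w : ℝ) / m + 1
        + lam * (Real.logb 2 y + potential w / (y * Real.log 2))) := by
  have hl := one_lt_lam
  have hlog : 0 < Real.log 2 := Real.log_pos (by norm_num)
  obtain ⟨hr0, hr1⟩ := idleCount_div_mem hm w
  set ρ : ℝ := (idleCount w : ℝ) / m
  set δ : ℝ := (2 : ℝ) ^ (-(ρ / lam)) with hδ
  have hδ0 : 0 < δ := by positivity
  have hδ1 : 1 / 2 ≤ δ := by
    have : (2 : ℝ) ^ (-1 : ℝ) ≤ (2 : ℝ) ^ (-(ρ / lam)) := by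
      refine Real.rpow_le_rpow_of_exponent_le (by norm_num) (neg_le_neg ?_)
      rw [div_le_one (by linarith)]; linarith
    rw [Real.rpow_neg_one] at this
    linarith
  have hy' : 1 ≤ y * δ := by nlinarith
  have hlogb : Real.logb 2 (y * δ) = Real.logb 2 y - ρ / lam := by
    rw [Real.logb_mul (by linarith) hδ0.ne', hδ, Real.logb_rpow (by norm_num) (by norm_num)]
    ring
  have hlogb0 : 0 ≤ Real.logb 2 (y * δ) := Real.logb_nonneg (by norm_num) hy'
  have hW := totalWork_div_nonneg hm w
  have hΦ := potential_nonneg w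
  set a : ℝ := totalWork w / m - 1 + ρ + 1 + lam * Real.logb 2 (y * δ) with ha
  have ha0 : 0 ≤ a := by
    have : 0 ≤ lam * Real.logb 2 (y * δ) := mul_nonneg (by linarith) hlogb0
    linarith
  set b : ℝ := lam / (y * δ * Real.log 2) with hb
  have hb0 : 0 ≤ b := div_nonneg (by linarith) (by positivity)
  have h1 : stepExpect hm (fun w' => ∑ t ∈ Finset.range n, aliveProb hm t w') w ≤
      ENNReal.ofReal (a + b * (δ * potential w)) := by
    refine le_trans (stepExpect_mono hm _
      (fun w' => ENNReal.ofReal (a + b * potential w')) w fun T _ V hV => ?_)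
      (stepExpect_affine_le hm w ha0 hb0)
    refine (ih _ _ hy').trans (le_of_eq ?_)
    rw [totalWork_next_div hm w T V hV, ha, hb]
    congr 1
    ring
  rw [sum_range_succ_aliveProb]
  refine (add_le_add (aliveProb_le_one hm 0 w) h1).trans (le_of_eq ?_)
  rw [← ENNReal.ofReal_one, ← ENNReal.ofReal_add zero_le_one (by positivity), ha, hb, hlogb]
  congr 1
  have : y ≠ 0 := by linarith
  field_simp
  ring

/-- Concavity of the logarithm: `y = φ` is the best parameter. -/
lemma logb_add_inv_log_le {φ y : ℝ} (hφ : 0 < φ) (hy : 0 < y) :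
    Real.logb 2 φ + 1 / Real.log 2 ≤ Real.logb 2 y + φ / (y * Real.log 2) := by
  have hlog : 0 < Real.log 2 := Real.log_pos (by norm_num)
  have h := Real.log_le_sub_one_of_pos (div_pos hφ hy)
  rw [Real.log_div hφ.ne' hy.ne'] at h
  rw [Real.logb, Real.logb, ← div_div, ← add_div, ← add_div]
  exact div_le_div_of_nonneg_right (by linarith) hlog.le

lemma sum_aliveProb_le {m : ℕ} (hm : 2 ≤ m) (n : ℕ) (w : Config m) (y : ℝ) (hy : 1 ≤ y) :
    ∑ t ∈ Finset.range n, aliveProb hm t w ≤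
      ENNReal.ofReal ((totalWork w : ℝ) / m + 1
        + lam * (Real.logb 2 y + potential w / (y * Real.log 2))) := by
  have hl := one_lt_lam
  have hlog : 0 < Real.log 2 := Real.log_pos (by norm_num)
  induction n generalizing w y with
  | zero => simp
  | succ n ih =>
    by_cases hw : Balanced w
    · refine (hw.sum_aliveProb_le hm _).trans (ENNReal.ofReal_le_ofReal ?_)
      have h1 : 0 ≤ Real.logb 2 y := Real.logb_nonneg (by norm_num) hy
      have h2 : 0 ≤ potential w / (y * Real.log 2) :=
        div_nonneg (potential_nonneg w) (by positivity)
      have : 0 ≤ lam * (Real.logb 2 y + potential w / (y * Real.log 2)) :=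
        mul_nonneg (by linarith) (by linarith)
      linarith
    have h2 := two_le_potential w hw
    -- The step is made with the optimal parameter `y = potential w`, which is at least `2` here;
    -- the bound for the given `y` is weaker.
    refine (sum_aliveProb_le_of_not_balanced hm n w (potential w) h2 ih).trans
      (ENNReal.ofReal_le_ofReal ?_)
    have := logb_add_inv_log_le (show 0 < potential w by linarith) (show 0 < y by linarith)
    rw [← div_div, div_self (by linarith)]
    gcongr

/-! ### The upper bounds -/

theorem expectedMakespan_le_of_balanced {m : ℕ} (hm : 2 ≤ m) (w₀ : Config m)
    (hw : Balanced w₀) :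
    expectedMakespan hm w₀ ≤ ENNReal.ofReal ((totalWork w₀ : ℝ) / m + 1) :=
  (expectedMakespan_le_tsum hm w₀).trans <|
    ENNReal.tsum_le_of_sum_range_le fun n => hw.sum_aliveProb_le hm n

theorem expectedMakespan_le {m : ℕ} (hm : 2 ≤ m) (w₀ : Config m) (h : 0 < potential w₀) :
    expectedMakespan hm w₀ ≤ ENNReal.ofReal ((totalWork w₀ : ℝ) / m
      + lam * (Real.logb 2 (potential w₀) + 1 / Real.log 2) + 1) := by
  have hl := one_lt_lam
  have hlog : 0 < Real.log 2 := Real.log_pos (by norm_num)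
  by_cases hw : Balanced w₀
  · refine (expectedMakespan_le_of_balanced hm w₀ hw).trans (ENNReal.ofReal_le_ofReal ?_)
    -- A balanced configuration may have potential below `1`, but not below `1/2`; the negative
    -- logarithm is then compensated by `1 / Real.log 2 ≥ 1`.
    have h1 : -1 ≤ Real.logb 2 (potential w₀) := by
      rw [Real.le_logb_iff_rpow_le (by norm_num) h, Real.rpow_neg_one]
      simpa using half_le_potential w₀ h
    have h2 : 1 ≤ 1 / Real.log 2 := by
      rw [le_div_iff₀ hlog]; linarith [Real.log_two_lt_d9]
    have : 0 ≤ lam * (Real.logb 2 (potential w₀) + 1 / Real.log 2) :=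
      mul_nonneg (by linarith) (by linarith)
    linarith
  · have h2 := two_le_potential w₀ hw
    refine (expectedMakespan_le_tsum hm w₀).trans <|
      ENNReal.tsum_le_of_sum_range_le fun n =>
        (sum_aliveProb_le hm n w₀ (potential w₀) (by linarith)).trans (le_of_eq ?_)
    rw [← div_div, div_self h.ne']
    congr 1
    ring

theorem tailMakespan_le_of_potential {m : ℕ} (hm : 2 ≤ m) (w₀ : Config m) (ε : ℝ) (hε : 0 < ε)
    (h : 1 ≤ potential w₀ ∨ ε ≤ potential w₀) :
    tailMakespan hm w₀ ((totalWork w₀ : ℝ) / m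
      + lam * (Real.logb 2 (potential w₀) + Real.logb 2 (1 / ε)) + 1) ≤ ENNReal.ofReal ε := by
  have hl := one_lt_lam
  by_cases h1 : 1 ≤ ε
  · exact prob_le_one.trans (ENNReal.one_le_ofReal.mpr h1)
  have hle : ε ≤ potential w₀ := by rcases h with h | h <;> linarith
  have hΦ : 0 < potential w₀ := by linarith
  have hlogb : Real.logb 2 (potential w₀) + Real.logb 2 (1 / ε) =
      Real.logb 2 (potential w₀ / ε) := by
    rw [← Real.logb_mul hΦ.ne' (by positivity)]
    congr 1; ring
  rw [hlogb]
  set x : ℝ := lam * Real.logb 2 (potential w₀ / ε) with hx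
  have hx0 : 0 ≤ x := mul_nonneg (by linarith)
    (Real.logb_nonneg (by norm_num) ((one_le_div hε).mpr hle))
  have hW : 0 ≤ (totalWork w₀ : ℝ) / m := by positivity
  -- The final `+ 1` of the threshold leaves room for an integer time that is at least `W/m + x` and
  -- strictly below the threshold.
  set t := ⌈(totalWork w₀ : ℝ) / m + x⌉₊
  have ht : (totalWork w₀ : ℝ) / m + x ≤ t := Nat.le_ceil _
  have ht' : (t : ℝ) < (totalWork w₀ : ℝ) / m + x + 1 := Nat.ceil_lt_add_one (by linarith)
  refine (tailMakespan_le hm w₀ _ t ht').trans ((aliveProb_le hm t w₀ x hx0 ht).trans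
    (le_of_eq ?_))
  have : x / lam = Real.logb 2 (potential w₀ / ε) := by
    rw [hx]; field_simp
  rw [this, Real.rpow_neg (by norm_num), Real.rpow_logb (by norm_num) (by norm_num)
    (by positivity)]
  congr 1
  field_simp

lemma potential_le_sq {m : ℕ} (hm : m ≠ 0) (w : Config m) :
    potential w ≤ (totalWork w : ℝ) ^ 2 := by
  rw [potential_eq hm]
  have h1 : ∑ i, (w i : ℝ) ^ 2 ≤ (∑ i, (w i : ℝ)) ^ 2 :=
    Finset.sum_sq_le_sq_sum_of_nonneg fun _ _ => Nat.cast_nonneg _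
  have h2 : (∑ i, (w i : ℝ)) = totalWork w := by simp [totalWork]
  rw [h2] at h1
  have : 0 ≤ (totalWork w : ℝ) ^ 2 / m := by positivity
  linarith

theorem expectedMakespan_le_totalWork {m : ℕ} (hm : 2 ≤ m) (w₀ : Config m)
    (h : 0 < totalWork w₀) :
    expectedMakespan hm w₀ ≤ ENNReal.ofReal ((totalWork w₀ : ℝ) / m
      + 2 * lam * (Real.logb 2 (totalWork w₀) + 1 / (2 * Real.log 2)) + 1) := by
  have hl := one_lt_lam
  have hlog : 0 < Real.log 2 := Real.log_pos (by norm_num)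
  have hW : (1 : ℝ) ≤ totalWork w₀ := by exact_mod_cast h
  rcases (potential_nonneg w₀).eq_or_lt with h0 | h0
  · have hb : Balanced w₀ := by
      by_contra hb
      linarith [two_le_potential w₀ hb]
    refine (expectedMakespan_le_of_balanced hm w₀ hb).trans (ENNReal.ofReal_le_ofReal ?_)
    have h1 : 0 ≤ Real.logb 2 (totalWork w₀) := Real.logb_nonneg (by norm_num) hW
    have : 0 ≤ 2 * lam * (Real.logb 2 (totalWork w₀) + 1 / (2 * Real.log 2)) := by positivity
    linarith
  · refine (expectedMakespan_le hm w₀ h0).trans (ENNReal.ofReal_le_ofReal ?_)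
    have h1 : Real.logb 2 (potential w₀) ≤ 2 * Real.logb 2 (totalWork w₀) := by
      have := Real.logb_le_logb_of_le (b := 2) (by norm_num) h0 (potential_le_sq (by omega) w₀)
      rw [Real.logb_pow] at this
      exact_mod_cast this
    have h2 : 2 * lam * (Real.logb 2 (totalWork w₀) + 1 / (2 * Real.log 2)) =
        lam * (2 * Real.logb 2 (totalWork w₀) + 1 / Real.log 2) := by field_simp
    rw [h2]
    gcongr

/-! ### The lower bound -/

/-- A robbed queue keeps `⌈(w i - 1)/2⌉ = ⌊w i / 2⌋` tasks, and any other active queue at least as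
many. -/
lemma half_le_next {m : ℕ} (w : Config m) (T V : Fin m → Fin m) (i : Fin m) :
    w i / 2 ≤ next w T V i := by
  simp only [next]
  split_ifs <;> omega

lemma aliveProb_eq_one {m : ℕ} (hm : 2 ≤ m) (t : ℕ) (w : Config m) (i : Fin m)
    (h : 2 ^ t ≤ w i) : aliveProb hm t w = 1 := by
  induction t generalizing w with
  | zero =>
    rw [aliveProb_zero, if_neg]
    rintro rfl
    simp at h
  | succ t ih =>
    refine le_antisymm (aliveProb_le_one hm _ w) ?_
    rw [aliveProb_succ]
    have h1 : stepExpect hm (fun _ => 1) w = 1 := by simp [stepExpect, PMF.tsum_coe]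
    nth_rewrite 1 [← h1]
    refine stepExpect_mono hm _ _ w fun T _ V _ => (ih _ ?_).ge
    have := half_le_next w T V i
    rw [pow_succ] at h
    omega

lemma ae_le_makespan {m : ℕ} (hm : 2 ≤ m) (w₀ : Config m) (n : ℕ) (i : Fin m)
    (h : 2 ^ n ≤ w₀ i) :
    ∀ᵐ w ∂(executionLaw hm w₀), ((n + 1 : ℕ) : ℕ∞) ≤ makespan w := by
  have h1 : ∀ t < n + 1, ∀ᵐ w ∂(executionLaw hm w₀), w t ≠ 0 := fun t ht => by
    have hms : MeasurableSet {w : ℕ → Config m | w t ≠ 0} :=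
      (measurableSet_singleton (0 : Config m)).compl.preimage (measurable_pi_apply t)
    refine (mem_ae_iff_prob_eq_one hms).mpr ?_
    rw [executionLaw_ne_zero]
    exact aliveProb_eq_one hm t w₀ i ((Nat.pow_le_pow_right (by norm_num) (by omega)).trans h)
  have h2 : ∀ᵐ w ∂(executionLaw hm w₀), ∀ t < n + 1, w t ≠ 0 := by
    rw [ae_all_iff]
    intro t
    by_cases ht : t < n + 1
    · filter_upwards [h1 t ht] with w hw _ using hw
    · exact Filter.Eventually.of_forall fun w ht' => absurd ht' ht
  filter_upwards [h2] with w hw using (le_makespan_iff w (n + 1)).mpr hw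

lemma ae_ofReal_le_makespan {m : ℕ} (hm : 2 ≤ m) (w₀ : Config m) (n : ℕ) (i : Fin m)
    (h : 2 ^ n ≤ w₀ i) {x : ℝ} (hx : x ≤ n + 1) :
    ∀ᵐ w ∂(executionLaw hm w₀), ENNReal.ofReal x ≤ (makespan w : ℝ≥0∞) := by
  filter_upwards [ae_le_makespan hm w₀ n i h] with w hw
  rw [← ENat.toENNReal_le, ENat.toENNReal_coe, ← ENNReal.ofReal_natCast] at hw
  exact (ENNReal.ofReal_le_ofReal (by exact_mod_cast hx)).trans hw

lemma ofReal_le_expectedMakespan {m : ℕ} (hm : 2 ≤ m) (w₀ : Config m) (n : ℕ) (i : Fin m)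
    (h : 2 ^ n ≤ w₀ i) {x : ℝ} (hx : x ≤ n + 1) :
    ENNReal.ofReal x ≤ expectedMakespan hm w₀ := by
  calc ENNReal.ofReal x = ∫⁻ _, ENNReal.ofReal x ∂(executionLaw hm w₀) := by simp
    _ ≤ _ := lintegral_mono_ae (ae_ofReal_le_makespan hm w₀ n i h hx)

lemma tailMakespan_eq_one {m : ℕ} (hm : 2 ≤ m) (w₀ : Config m) (n : ℕ) (i : Fin m)
    (h : 2 ^ n ≤ w₀ i) {x : ℝ} (hx : x ≤ n + 1) : tailMakespan hm w₀ x = 1 := by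
  rw [tailMakespan, ← measure_univ (μ := executionLaw hm w₀)]
  refine measure_congr ?_
  filter_upwards [ae_ofReal_le_makespan hm w₀ n i h hx] with w hw
  exact propext ⟨fun _ => trivial, fun _ => hw⟩

section SingleQueue

variable {k : ℕ} (i₀ : Fin (2 ^ k))

lemma totalWork_single : totalWork (Pi.single i₀ (2 ^ (k + 1)) : Config (2 ^ k)) = 2 ^ (k + 1) := by
  simp [totalWork]

lemma totalWork_single_div :
    (totalWork (Pi.single i₀ (2 ^ (k + 1)) : Config (2 ^ k)) : ℝ) / ((2 ^ k : ℕ) : ℝ) = 2 := by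
  rw [totalWork_single]
  push_cast
  field_simp
  ring

lemma logb_totalWork_single :
    Real.logb 2 (totalWork (Pi.single i₀ (2 ^ (k + 1)) : Config (2 ^ k))) = k + 1 := by
  rw [totalWork_single]
  push_cast
  rw [Real.logb_pow, Real.logb_self_eq_one (by norm_num)]
  push_cast
  ring

lemma potential_single :
    potential (Pi.single i₀ (2 ^ (k + 1)) : Config (2 ^ k)) = 2 ^ (2 * k + 2) - 2 ^ (k + 2) := by
  have h : ∑ i, (((Pi.single i₀ (2 ^ (k + 1)) : Config (2 ^ k)) i : ℕ) : ℝ) ^ 2 =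
      ((2 : ℝ) ^ (k + 1)) ^ 2 := by
    rw [Finset.sum_eq_single i₀]
    · simp
    · intro j _ hj; simp [hj]
    · simp
  rw [potential_eq (by positivity), h, totalWork_single]
  push_cast
  field_simp
  ring

lemma one_le_potential_single (hm : 2 ≤ 2 ^ k) :
    1 ≤ potential (Pi.single i₀ (2 ^ (k + 1)) : Config (2 ^ k)) := by
  have h : (2 : ℝ) ≤ 2 ^ k := by exact_mod_cast hm
  rw [potential_single, show (2 : ℝ) ^ (2 * k + 2) - 2 ^ (k + 2) = 4 * 2 ^ k * (2 ^ k - 1) by ring]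
  nlinarith

lemma logb_potential_single_mem (hm : 2 ≤ 2 ^ k) :
    0 ≤ Real.logb 2 (potential (Pi.single i₀ (2 ^ (k + 1)) : Config (2 ^ k))) ∧
    Real.logb 2 (potential (Pi.single i₀ (2 ^ (k + 1)) : Config (2 ^ k))) ≤ 2 * k + 2 := by
  have h1 := one_le_potential_single i₀ hm
  refine ⟨Real.logb_nonneg (by norm_num) h1, ?_⟩
  have := Real.logb_le_logb_of_le (b := 2) (by norm_num) (by linarith)
    (potential_le_sq (by positivity) (Pi.single i₀ (2 ^ (k + 1)) : Config (2 ^ k)))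
  rw [Real.logb_pow, logb_totalWork_single] at this
  push_cast at this
  linarith

end SingleQueue

lemma one_le_of_forall_le {a b : ℝ} (h : ∀ k : ℕ, 1 ≤ k → (k : ℝ) ≤ a * k + b) : 1 ≤ a := by
  by_contra! ha
  obtain ⟨n, hn⟩ := exists_nat_gt (b / (1 - a))
  rw [div_lt_iff₀ (by linarith)] at hn
  have := h (n + 1) (by omega)
  push_cast at this
  nlinarith

lemma half_le_of_forall_le {c C : ℝ} (h : ∀ k : ℕ, 1 ≤ k → ∃ L : ℝ, 0 ≤ L ∧ L ≤ 2 * k + 2 ∧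
    (k : ℝ) ≤ c * L + C) : 1 / 2 ≤ c := by
  -- The sign of `c` is not known beforehand; `max c 0` allows the upper bound on `L` to be
  -- multiplied.
  have h1 : 1 ≤ 2 * max c 0 := by
    refine one_le_of_forall_le (b := 2 * max c 0 + C) fun k hk => ?_
    obtain ⟨L, hL0, hL, hk'⟩ := h k hk
    have e1 : c * L ≤ max c 0 * L := mul_le_mul_of_nonneg_right (le_max_left _ _) hL0
    have e2 : max c 0 * L ≤ max c 0 * (2 * k + 2) :=
      mul_le_mul_of_nonneg_left hL (le_max_right _ _)
    linarith
  rcases max_cases c 0 with h | h <;> linarith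

lemma two_le_two_pow {k : ℕ} (hk : 1 ≤ k) : 2 ≤ 2 ^ k := by
  simpa using Nat.pow_le_pow_right (n := 2) (by norm_num) hk

lemma le_of_expectedMakespan_single_le {k : ℕ} (hm : 2 ≤ 2 ^ k) (i₀ : Fin (2 ^ k)) {x : ℝ}
    (h : expectedMakespan hm (Pi.single i₀ (2 ^ (k + 1))) ≤ ENNReal.ofReal x) :
    (k : ℝ) + 2 ≤ x := by
  have h1 := (ofReal_le_expectedMakespan hm (Pi.single i₀ (2 ^ (k + 1))) (k + 1) i₀ (by simp)
    (x := k + 2) (by push_cast; linarith)).trans h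
  by_contra! hlt
  exact absurd h1 (not_le.mpr ((ENNReal.ofReal_lt_ofReal_iff (by positivity)).mpr hlt))

end DLS

theorem theorem2 :
    -- upper bounds, for every number of processors and every initial repartition of the tasks
    (∀ (m : ℕ) (hm : 2 ≤ m) (w₀ : DLS.Config m),
      (0 < DLS.potential w₀ →
        DLS.expectedMakespan hm w₀ ≤
          ENNReal.ofReal ((DLS.totalWork w₀ : ℝ) / m
            + DLS.lam * (Real.logb 2 (DLS.potential w₀) + 1 / Real.log 2) + 1)) ∧
      (∀ ε : ℝ, 0 < ε → (1 ≤ DLS.potential w₀ ∨ ε ≤ DLS.potential w₀) →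
        DLS.tailMakespan hm w₀ ((DLS.totalWork w₀ : ℝ) / m
            + DLS.lam * (Real.logb 2 (DLS.potential w₀) + Real.logb 2 (1 / ε)) + 1) ≤
          ENNReal.ofReal ε) ∧
      (0 < DLS.totalWork w₀ →
        DLS.expectedMakespan hm w₀ ≤
          ENNReal.ofReal ((DLS.totalWork w₀ : ℝ) / m
            + 2 * DLS.lam * (Real.logb 2 (DLS.totalWork w₀) + 1 / (2 * Real.log 2)) + 1))) ∧
    2 * DLS.lam < 3.65 ∧
    -- the lower-bound instance: `2 ^ (k + 1)` tasks in one queue, on `2 ^ k` processors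
    (∀ (k : ℕ) (hm : 2 ≤ 2 ^ k) (i₀ : Fin (2 ^ k)) (w₀ : DLS.Config (2 ^ k)),
      w₀ = Pi.single i₀ (2 ^ (k + 1)) →
        (∀ᵐ w ∂(DLS.executionLaw hm w₀),
          ENNReal.ofReal ((DLS.totalWork w₀ : ℝ) / ((2 ^ k : ℕ) : ℝ)
            + Real.logb 2 (DLS.totalWork w₀) - 1) ≤ (DLS.makespan w : ENNReal)) ∧
        ENNReal.ofReal ((DLS.totalWork w₀ : ℝ) / ((2 ^ k : ℕ) : ℝ)
            + Real.logb 2 (DLS.totalWork w₀) - 1) ≤ DLS.expectedMakespan hm w₀) ∧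
    -- hence the three bounds are optimal up to a constant factor of the logarithmic term
    (∀ c C : ℝ,
      (∀ (m : ℕ) (hm : 2 ≤ m) (w₀ : DLS.Config m), 0 < DLS.potential w₀ →
        DLS.expectedMakespan hm w₀ ≤ ENNReal.ofReal ((DLS.totalWork w₀ : ℝ) / m
          + c * Real.logb 2 (DLS.potential w₀) + C)) → 1 / 2 ≤ c) ∧
    (∀ c C ε : ℝ, 0 < ε → ε < 1 →
      (∀ (m : ℕ) (hm : 2 ≤ m) (w₀ : DLS.Config m), 1 ≤ DLS.potential w₀ →
        DLS.tailMakespan hm w₀ ((DLS.totalWork w₀ : ℝ) / m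
          + c * Real.logb 2 (DLS.potential w₀) + C) ≤ ENNReal.ofReal ε) → 1 / 2 ≤ c) ∧
    (∀ c C : ℝ,
      (∀ (m : ℕ) (hm : 2 ≤ m) (w₀ : DLS.Config m), 0 < DLS.totalWork w₀ →
        DLS.expectedMakespan hm w₀ ≤ ENNReal.ofReal ((DLS.totalWork w₀ : ℝ) / m
          + c * Real.logb 2 (DLS.totalWork w₀) + C)) → 1 ≤ c) := by
  refine ⟨fun m hm w₀ => ⟨DLS.expectedMakespan_le hm w₀,
    DLS.tailMakespan_le_of_potential hm w₀, DLS.expectedMakespan_le_totalWork hm w₀⟩,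
    DLS.two_mul_lam_lt, ?_, ?_, ?_, ?_⟩
  · rintro k hm i₀ w₀ rfl
    have hx : (2 : ℝ) + (k + 1) - 1 ≤ ((k + 1 : ℕ) : ℝ) + 1 := by push_cast; linarith
    rw [DLS.totalWork_single_div, DLS.logb_totalWork_single]
    exact ⟨DLS.ae_ofReal_le_makespan hm _ (k + 1) i₀ (by simp) hx,
      DLS.ofReal_le_expectedMakespan hm _ (k + 1) i₀ (by simp) hx⟩
  · intro c C h
    refine DLS.half_le_of_forall_le (C := C) fun k hk => ?_
    have hm := DLS.two_le_two_pow hk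
    have i₀ : Fin (2 ^ k) := ⟨0, by positivity⟩
    have h1 := DLS.le_of_expectedMakespan_single_le hm i₀ (h (2 ^ k) hm _
      (zero_lt_one.trans_le (DLS.one_le_potential_single i₀ hm)))
    rw [DLS.totalWork_single_div] at h1
    obtain ⟨hL0, hL⟩ := DLS.logb_potential_single_mem i₀ hm
    exact ⟨_, hL0, hL, by linarith⟩
  · intro c C ε _ hε1 h
    refine DLS.half_le_of_forall_le (C := C) fun k hk => ?_
    have hm := DLS.two_le_two_pow hk
    have i₀ : Fin (2 ^ k) := ⟨0, by positivity⟩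
    have h1 := h (2 ^ k) hm _ (DLS.one_le_potential_single i₀ hm)
    rw [DLS.totalWork_single_div] at h1
    obtain ⟨hL0, hL⟩ := DLS.logb_potential_single_mem i₀ hm
    refine ⟨_, hL0, hL, ?_⟩
    -- Otherwise the threshold is below `k + 2`, which the makespan almost surely reaches, and the
    -- tail has probability `1 > ε`.
    by_contra! hlt
    rw [DLS.tailMakespan_eq_one hm _ (k + 1) i₀ (by simp) (by push_cast; linarith),
      ENNReal.one_le_ofReal] at h1
    linarith
  · intro c C h
    refine DLS.one_le_of_forall_le (b := c + C) fun k hk => ?_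
    have hm := DLS.two_le_two_pow hk
    have i₀ : Fin (2 ^ k) := ⟨0, by positivity⟩
    have h1 := DLS.le_of_expectedMakespan_single_le hm i₀ (h (2 ^ k) hm _
      (by rw [DLS.totalWork_single]; positivity))
    rw [DLS.totalWork_single_div, DLS.logb_totalWork_single] at h1
    linarith
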